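/- A \emph{generalized probabilistic Cops and Robbers game} $\mathcal G=(S,i_0,F,A,T_{\mathrm{cop}},T_{\mathrm{rob}})$ consists of a finite set of states $S$, an initial state $i_0\in S$, a set $F\subseteq S$ of final states, a finite set of actions $A=A_{\mathrm{cop}}\cup A_{\mathrm{rob}}$ and, for $x\in\{\mathrm{cop},\mathrm{rob}\}$, a function $T_x:S\times A_x\times S\to[0,1]$ such that $\sum_{s'\in S}T_x(s,a,s')\in\{0,1\}$ for all $s\in S$, $a\in A_x$; the set $A_x(s)$ of \emph{playable} actions (those for which the sum is $1$) is non-empty for every $s\in S$; and $T_x(s,a,s)=1$ for all $s\in F$, $a\in A_x$. A play from a state $s$ is an infinite sequence $s_0a_0s_1a_1s_2\dots$ with $s_0=s$, in which the cops choose a playable action $a_j\in A_{\mathrm{cop}}(s_j)$ for $j$ even, the robbers choose $a_j\in A_{\mathrm{rob}}(s_j)$ for $j$ odd, and $s_{j+1}$ is drawn according to $T_{\mathrm{cop}}(s_j,a_j,\cdot)$ for $j$ even and $T_{\mathrm{rob}}(s_j,a_j,\cdot)$ for $j$ odd. A (general, pure) strategy of a player assigns a playable action to each history $s_0a_0s_1\dots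 a_{j-1}s_j$ at which that player moves; it is \emph{memoryless} if the action depends only on $s_j$. Let $P(\sigma,\tau,s)$ be the probability that a play from $s$, in which the cops follow $\sigma$ and the robbers follow $\tau$, meets a state of $F$. The value of $\mathcal G$ is $p^*_{\mathcal G}=\max_\sigma\min_\tau P(\sigma,\tau,i_0)$ over memoryless strategies. A strategy $\sigma$ of the cops is \emph{optimal from} $s$ if it maximizes $\inf_\tau P(\sigma,\tau,s)$ among all general strategies of the cops, where $\tau$ ranges over all general strategies of the robbers. For $f:S\to\mathbb R$, $s\in S$ and $a\in A_{\mathrm{cop}}(s)$ let $$V_f(s,a)=\sum_{s'\in S}T_{\mathrm{cop}}(s,a,s')\min_{a'\in A_{\mathrm{rob}}(s')}\sum_{s''\in S}T_{\mathrm{rob}}(s',a',s'')f(s''),$$ let $\mathcal F(f)(s)=1$ if $s\in F$ and $\mathcal F(f)(s)=\max_{a\in A_{\mathrm{cop}}(s)}V_f(s,a)$ if $s\notin F$. Let $w_0$ be the indicator function of $F$ and $w_{n}=\mathcal F(w_{n-1})$ for $n\ge 1$. \textbf{Theorem.} The operator $\mathcal F$ is monotone for the pointwise order and maps functions $S\to[0,1]$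 to functions $S\to[0,1]$. The pointwise limit $w_\infty=\lim_{n\to\infty}w_n$ exists and satisfies $$w_\infty(s)=\begin{cases}1,& s\in F,\\ \displaystyle\max_{a\in A_{\mathrm{cop}}(s)}\sum_{s'\in S}T_{\mathrm{cop}}(s,a,s')\min_{a'\in A_{\mathrm{rob}}(s')}\sum_{s''\in S}T_{\mathrm{rob}}(s',a',s'')\,w_\infty(s''),& s\notin F,\end{cases}$$ and $w_\infty$ is the least fixed point of $\mathcal F$ among the functions $S\to[0,1]$. For every $s\in S$, $w_\infty(s)$ is the value of the infinite game started in $s$: $$w_\infty(s)=\max_\sigma\inf_\tau P(\sigma,\tau,s)=\min_\tau\sup_\sigma P(\sigma,\tau,s),$$ both when $\sigma,\tau$ range over general strategies and when they range over memoryless strategies, the outer maximum and minimum being attained; in particular $w_\infty(i_0)=p^*_{\mathcal G}$. There is a memoryless strategy $\sigma$ of the cops that is optimal from every state and such that, for every $s\notin F$, the action $\sigma(s)$ attains $\max_{a\in A_{\mathrm{cop}}(s)}V_{w_\infty}(s,a)$. Conversely, if a memoryless strategy $\sigma$ of the cops is optimal from every state, then $\sigma(s)$ attains this maximum for every $s\notin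 F$. -/

import Mathlib

open Filter Topology MeasureTheory ProbabilityTheory

/-- `T : S × Acts × S → [0,1]` is a transition function for a player with finite action set `Acts`,
on a state set `S` with final states `F`. The total mass of `T s a` is `0` or `1` and `a` is playable
in `s` when it is `1`; some action is playable in every state; final states are absorbing under every
action. -/
structure IsTransition {S A : Type*} [Fintype S] (F : Set S) (Acts : Finset A)
    (T : S → A → S → ℝ) : Prop where
  nonneg : ∀ s, ∀ a ∈ Acts, ∀ s', 0 ≤ T s a s'
  sum_eq : ∀ s, ∀ a ∈ Acts, ∑ s', T s a s' = 0 ∨ ∑ s', T s a s' = 1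
  exists_playable : ∀ s, ∃ a ∈ Acts, ∑ s', T s a s' = 1
  absorbing : ∀ s ∈ F, ∀ a ∈ Acts, T s a s = 1

/-- A Generalized Probabilistic Cops and Robbers game with finite state set `S` and action sets
`copActs`, `robActs` contained in the finite type `A`. -/
structure GPCR (S A : Type*) [Fintype S] [Fintype A] where
  /-- initial state -/
  start : S
  /-- final states, winning for the cops -/
  final : Set S
  copActs : Finset A
  robActs : Finset A
  Tcop : S → A → S → ℝ
  Trob : S → A → S → ℝ
  isTransition_cop : IsTransition final copActs Tcop
  isTransition_rob : IsTransition final robActs Trob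

/-- One entry of a play: a state and the action chosen there by the player whose move it is. -/
structure Move (S A : Type*) where
  state : S
  action : A

instance {S A : Type*} [Finite S] [Finite A] : Finite (Move S A) :=
  Finite.of_injective (fun m : Move S A => (m.state, m.action)) (by
    rintro ⟨s, a⟩ ⟨s', a'⟩ h
    simpa using h)

instance {S A : Type*} : MeasurableSpace (Move S A) := ⊤

instance {S A : Type*} : DiscreteMeasurableSpace (Move S A) := ⟨fun _ => trivial⟩

/-- A general pure strategy: from the `n` earlier (state, action) pairs of a history and from its
last state, it prescribes an action. -/
abbrev GenStrategy (S A : Type*) := (n : ℕ) → (Fin n → Move S A) → S → A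

namespace GPCR

variable {S A : Type*} [Fintype S] [Fintype A] (G : GPCR S A)

open Classical in
/-- The actions that the cops can play in `s`. -/
noncomputable def copPlayable (s : S) : Finset A :=
  G.copActs.filter (fun a => ∑ s', G.Tcop s a s' = 1)

open Classical in
/-- The actions that the robbers can play in `s`. -/
noncomputable def robPlayable (s : S) : Finset A :=
  G.robActs.filter (fun a => ∑ s', G.Trob s a s' = 1)

theorem copPlayable_nonempty (s : S) : (G.copPlayable s).Nonempty := by
  obtain ⟨a, ha, h⟩ := G.isTransition_cop.exists_playable s
  exact ⟨a, by simp [copPlayable, ha, h]⟩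

theorem robPlayable_nonempty (s : S) : (G.robPlayable s).Nonempty := by
  obtain ⟨a, ha, h⟩ := G.isTransition_rob.exists_playable s
  exact ⟨a, by simp [robPlayable, ha, h]⟩

/-! ### The recursion -/

/-- The expression inside the maximum: the cops play `a` in `s`, then the robbers minimize the
expected value of `f`. -/
noncomputable def actionValue (f : S → ℝ) (s : S) (a : A) : ℝ :=
  ∑ s', G.Tcop s a s' *
    (G.robPlayable s').inf' (G.robPlayable_nonempty s') (fun a' => ∑ s'', G.Trob s' a' s'' * f s'')

open Classical in
/-- The max-min operator. -/
noncomputable def operator (f : S → ℝ) (s : S) : ℝ :=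
  if s ∈ G.final then 1
  else (G.copPlayable s).sup' (G.copPlayable_nonempty s) (fun a => G.actionValue f s a)

open Classical in
/-- The sequence `w n`. -/
noncomputable def w : ℕ → S → ℝ
  | 0 => fun s => if s ∈ G.final then 1 else 0
  | n + 1 => G.operator (w n)

/-! ### Strategies -/

/-- General strategies of the cops, who move at even times and choose playable actions. -/
def CopStrategy : Type _ :=
  {σ : GenStrategy S A // ∀ n h s, Even n → σ n h s ∈ G.copPlayable s}

/-- General strategies of the robbers, who move at odd times and choose playable actions. -/
def RobStrategy : Type _ :=
  {τ : GenStrategy S A // ∀ n h s, Odd n → τ n h s ∈ G.robPlayable s}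

/-- Memoryless strategies of the cops. -/
def CopMemoryless : Type _ := {σ : S → A // ∀ s, σ s ∈ G.copPlayable s}

/-- Memoryless strategies of the robbers. -/
def RobMemoryless : Type _ := {τ : S → A // ∀ s, τ s ∈ G.robPlayable s}

variable {G}

/-- A memoryless strategy seen as a general strategy. -/
def CopMemoryless.toGen (σ : G.CopMemoryless) : G.CopStrategy :=
  ⟨fun _ _ s => σ.1 s, fun _ _ s _ => σ.2 s⟩

/-- A memoryless strategy seen as a general strategy. -/
def RobMemoryless.toGen (τ : G.RobMemoryless) : G.RobStrategy :=
  ⟨fun _ _ s => τ.1 s, fun _ _ s _ => τ.2 s⟩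

/-! ### The law of the play -/

/-- The action chosen at time `n`, by the cops if `n` is even and by the robbers if `n` is odd. -/
noncomputable def choice (σ : G.CopStrategy) (τ : G.RobStrategy) (n : ℕ) (h : Fin n → Move S A)
    (s : S) : A :=
  if Even n then σ.1 n h s else τ.1 n h s

variable (G)

/-- The transition function of the player who moves at time `n`. -/
noncomputable def trans (n : ℕ) : S → A → S → ℝ := if Even n then G.Tcop else G.Trob

open Classical in
/-- The law of the state at time `n + 1`, given the state `s` and the action `a` at time `n`. For
pairs where `T s a` is not a probability distribution (which plays following strategies never
contain) the state is kept. -/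
noncomputable def nextState (n : ℕ) (s : S) (a : A) : PMF S :=
  if h : ∑ s', ENNReal.ofReal (G.trans n s a s') = 1 then
    PMF.ofFintype (fun s' => ENNReal.ofReal (G.trans n s a s')) h
  else PMF.pure s

variable {G}

/-- The law of the entry of the play at time `n + 1`, given the entries up to time `n`. -/
noncomputable def stepKernel (σ : G.CopStrategy) (τ : G.RobStrategy) (n : ℕ) :
    Kernel ((i : Finset.Iic n) → Move S A) (Move S A) where
  toFun x :=
    ((G.nextState n (x ⟨n, by simp⟩).state (x ⟨n, by simp⟩).action).map (fun s' =>
      (⟨s', choice σ τ (n + 1)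
        (fun i => x ⟨i, Finset.mem_Iic.2 (Nat.lt_succ_iff.1 i.2)⟩) s'⟩ : Move S A))).toMeasure
  measurable' := measurable_of_finite _

instance (σ : G.CopStrategy) (τ : G.RobStrategy) (n : ℕ) : IsMarkovKernel (stepKernel σ τ n) :=
  ⟨fun x => by
    change IsProbabilityMeasure (PMF.toMeasure _)
    infer_instance⟩

/-- The law of the infinite play that starts in `s`, cops first, when the cops follow `σ` and the
robbers follow `τ`. -/
noncomputable def playMeasure (σ : G.CopStrategy) (τ : G.RobStrategy) (s : S) :
    Measure (ℕ → Move S A) :=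
  Kernel.traj (X := fun _ => Move S A) (stepKernel σ τ) 0
    (fun _ => ⟨s, choice σ τ 0 Fin.elim0 s⟩)

/-- The probability that a final state is met in the infinite play that starts in `s`. -/
noncomputable def captureProb (σ : G.CopStrategy) (τ : G.RobStrategy) (s : S) : ℝ :=
  (playMeasure σ τ s).real {ω | ∃ n, (ω n).state ∈ G.final}

/-! ### Values and optimality -/

variable (G)

/-- The value of the game, as the max-min of the capture probability from the initial state over
memoryless strategies. -/
noncomputable def value : ℝ :=
  ⨆ σ : G.CopMemoryless, ⨅ τ : G.RobMemoryless, captureProb σ.toGen τ.toGen G.start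

variable {G}

/-- `σ` is optimal from `s`: no general strategy of the cops guarantees a larger probability of
capture against all general strategies of the robbers. -/
def IsOptimalFrom (σ : G.CopStrategy) (s : S) : Prop :=
  ∀ σ' : G.CopStrategy,
    ⨅ τ : G.RobStrategy, captureProb σ' τ s ≤ ⨅ τ : G.RobStrategy, captureProb σ τ s

/-- In every non-final state, `σ` chooses an action that attains the maximum in the max-min
expression with `f`. -/
def AttainsMax (f : S → ℝ) (σ : G.CopMemoryless) : Prop :=
  ∀ s, s ∉ G.final → ∀ a ∈ G.copPlayable s, G.actionValue f s a ≤ G.actionValue f s (σ.1 s)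

end GPCR

/-- `v` is the value of the zero-sum game with payoff `f`, maximized by the first player and
minimized by the second one: it is the max-inf and the min-sup of `f`, the outer maximum and the
outer minimum being attained. -/
def IsGameValue {X Y : Type*} (f : X → Y → ℝ) (v : ℝ) : Prop :=
  IsGreatest (Set.range fun x => ⨅ y, f x y) v ∧ IsLeast (Set.range fun y => ⨆ x, f x y) v

/-!
Let `w∞` be the limit of the increasing sequence `w n`; it is the least fixed point of the max-min
operator because the operator is monotone and continuous. It is the value of the game because it is
attained by a saddle point of memoryless strategies, found by following, along the play, the mean of
a *potential*: a function `f` at the times when the cops move, and the value that the robbers can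
enforce for `f` with one move (`robValue f`) at the times when the robbers move. Only the marginal
laws of the play are needed: `stateMean_succ_le` and `stateMean_le_succ` turn inequalities for single
moves into inequalities between the means at consecutive times. As final states are absorbing, the
capture probability is the limit of the probabilities `p n` that the state at time `n` is final
(`tendsto_stateMean_finalInd`).

*Robbers.* If the robbers always minimize the expectation of `w∞`, the mean of the potential of `w∞`
is nonincreasing against every strategy of the cops and bounds `p n` from above. So the capture
probability is at most `w∞ s` (`captureProb_le_wLim`). If the cops play a memoryless `σ`, comparing
with time `1` bounds it by the value of the action `σ s` (`captureProb_le_actionValue`), which gives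
the converse statement that optimal memoryless strategies select maximizing actions.

*Cops.* An action that maximizes the value for `w∞` need not make progress towards a final state, so
the optimal strategy is obtained by discounting. For `0 < c < 1` let `g = sup_n c ^ n * w n`. Off the
final states `g` is at most `c` times its best action value, and for the memoryless `σ` that selects
best actions for `g`, the means `x n` of the potential of `g` increase and satisfy
`x n ≤ c * x (n + 1) + (1 - c) * p n` at even `n`. In the limit `x ≤ p`, so `σ` guarantees `g`
(`le_captureProb_of_le_mul_actionValue`). There are finitely many memoryless strategies, so a single
one arises for values of `c` arbitrarily close to `1`, and it guarantees `w∞`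
(`exists_copMemoryless_wLim_le`). That it selects maximizing actions for `w∞` follows from the
converse statement.
-/

namespace GPCR

variable {S A : Type*} [Fintype S] [Fintype A] (G : GPCR S A)

/-! ### One move of a player -/

/-- The actions playable in `s` by the player who moves at time `n`. -/
noncomputable def playable (n : ℕ) (s : S) : Finset A :=
  if Even n then G.copPlayable s else G.robPlayable s

/-- The expectation of `f` at the state reached at time `n + 1` from state `s` and action `a`. -/
noncomputable def expect (n : ℕ) (s : S) (a : A) (f : S → ℝ) : ℝ :=
  ∑ s', G.trans n s a s' * f s'

variable {G}

theorem playable_of_even {n : ℕ} (hn : Even n) (s : S) : G.playable n s = G.copPlayable s :=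
  if_pos hn

theorem playable_of_odd {n : ℕ} (hn : Odd n) (s : S) : G.playable n s = G.robPlayable s :=
  if_neg (Nat.not_even_iff_odd.2 hn)

theorem trans_of_even {n : ℕ} (hn : Even n) : G.trans n = G.Tcop := if_pos hn

theorem trans_of_odd {n : ℕ} (hn : Odd n) : G.trans n = G.Trob :=
  if_neg (Nat.not_even_iff_odd.2 hn)

theorem trans_nonneg {n : ℕ} {s : S} {a : A} (ha : a ∈ G.playable n s) (s' : S) :
    0 ≤ G.trans n s a s' := by
  rcases Nat.even_or_odd n with hn | hn
  · rw [playable_of_even hn, copPlayable, Finset.mem_filter] at ha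
    rw [trans_of_even hn]
    exact G.isTransition_cop.nonneg s a ha.1 s'
  · rw [playable_of_odd hn, robPlayable, Finset.mem_filter] at ha
    rw [trans_of_odd hn]
    exact G.isTransition_rob.nonneg s a ha.1 s'

theorem sum_trans {n : ℕ} {s : S} {a : A} (ha : a ∈ G.playable n s) :
    ∑ s', G.trans n s a s' = 1 := by
  rcases Nat.even_or_odd n with hn | hn
  · rw [playable_of_even hn, copPlayable, Finset.mem_filter] at ha
    rw [trans_of_even hn]
    exact ha.2
  · rw [playable_of_odd hn, robPlayable, Finset.mem_filter] at ha
    rw [trans_of_odd hn]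
    exact ha.2

theorem trans_self_of_mem_final {n : ℕ} {s : S} {a : A} (hs : s ∈ G.final)
    (ha : a ∈ G.playable n s) : G.trans n s a s = 1 := by
  rcases Nat.even_or_odd n with hn | hn
  · rw [playable_of_even hn, copPlayable, Finset.mem_filter] at ha
    rw [trans_of_even hn]
    exact G.isTransition_cop.absorbing s hs a ha.1
  · rw [playable_of_odd hn, robPlayable, Finset.mem_filter] at ha
    rw [trans_of_odd hn]
    exact G.isTransition_rob.absorbing s hs a ha.1

theorem trans_eq_zero_of_mem_final {n : ℕ} {s : S} {a : A} (hs : s ∈ G.final)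
    (ha : a ∈ G.playable n s) {s' : S} (h : s' ≠ s) : G.trans n s a s' = 0 := by
  classical
  have h1 := sum_trans ha
  rw [← Finset.add_sum_erase _ _ (Finset.mem_univ s), trans_self_of_mem_final hs ha,
    add_eq_left, Finset.sum_eq_zero_iff_of_nonneg fun s' _ => trans_nonneg ha s'] at h1
  exact h1 s' (Finset.mem_erase.2 ⟨h, Finset.mem_univ _⟩)

theorem expect_of_mem_final {n : ℕ} {s : S} {a : A} (hs : s ∈ G.final)
    (ha : a ∈ G.playable n s) (f : S → ℝ) : G.expect n s a f = f s := by
  rw [expect, Finset.sum_eq_single s]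
  · rw [trans_self_of_mem_final hs ha, one_mul]
  · intro s' _ h
    rw [trans_eq_zero_of_mem_final hs ha h, zero_mul]
  · simp

theorem expect_mono {n : ℕ} {s : S} {a : A} (ha : a ∈ G.playable n s) {f g : S → ℝ}
    (h : f ≤ g) : G.expect n s a f ≤ G.expect n s a g :=
  Finset.sum_le_sum fun s' _ => mul_le_mul_of_nonneg_left (h s') (trans_nonneg ha s')

theorem expect_const {n : ℕ} {s : S} {a : A} (ha : a ∈ G.playable n s) (c : ℝ) :
    G.expect n s a (fun _ => c) = c := by
  rw [expect, ← Finset.sum_mul, sum_trans ha, one_mul]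

theorem expect_const_mul (n : ℕ) (s : S) (a : A) (c : ℝ) (f : S → ℝ) :
    G.expect n s a (fun s' => c * f s') = c * G.expect n s a f := by
  rw [expect, expect, Finset.mul_sum]
  exact Finset.sum_congr rfl fun s' _ => by ring

theorem choice_mem_playable (σ : G.CopStrategy) (τ : G.RobStrategy) (n : ℕ)
    (h : Fin n → Move S A) (s : S) : choice σ τ n h s ∈ G.playable n s := by
  unfold choice playable
  split_ifs with hn
  · exact σ.2 n h s hn
  · exact τ.2 n h s (Nat.not_even_iff_odd.1 hn)

theorem sum_ofReal_trans {n : ℕ} {s : S} {a : A} (ha : a ∈ G.playable n s) :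
    ∑ s', ENNReal.ofReal (G.trans n s a s') = 1 := by
  rw [← ENNReal.ofReal_sum_of_nonneg fun s' _ => trans_nonneg ha s', sum_trans ha,
    ENNReal.ofReal_one]

theorem nextState_apply {n : ℕ} {s : S} {a : A} (ha : a ∈ G.playable n s) (s' : S) :
    G.nextState n s a s' = ENNReal.ofReal (G.trans n s a s') := by
  rw [nextState, dif_pos (sum_ofReal_trans ha), PMF.ofFintype_apply]

/-! ### The marginal laws of the play -/

/-- The entry at time `n` of a history up to time `n`. -/
abbrev lastMove {n : ℕ} (x : (i : Finset.Iic n) → Move S A) : Move S A := x ⟨n, by simp⟩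

theorem integral_stepKernel (σ : G.CopStrategy) (τ : G.RobStrategy) {n : ℕ}
    {x : (i : Finset.Iic n) → Move S A}
    (hx : (lastMove x).action ∈ G.playable n (lastMove x).state) (f : S → ℝ) :
    ∫ m, f m.state ∂stepKernel σ τ n x =
      G.expect n (lastMove x).state (lastMove x).action f := by
  let _ : MeasurableSpace S := ⊤
  have _ : DiscreteMeasurableSpace S := ⟨fun _ => trivial⟩
  change ∫ m : Move S A, f m.state ∂(PMF.toMeasure _) = _
  rw [← PMF.toMeasure_map (hf := .of_discrete),
    integral_map Measurable.of_discrete.aemeasurable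
      (Measurable.of_discrete (f := fun m : Move S A => f m.state)).aestronglyMeasurable,
    PMF.integral_eq_sum]
  refine Finset.sum_congr rfl fun s' _ => ?_
  rw [nextState_apply hx, ENNReal.toReal_ofReal (trans_nonneg hx s'), smul_eq_mul]

theorem ae_stepKernel (σ : G.CopStrategy) (τ : G.RobStrategy) {n : ℕ}
    {x : (i : Finset.Iic n) → Move S A} {p : Move S A → Prop}
    (h : ∀ s', G.nextState n (lastMove x).state (lastMove x).action s' ≠ 0 →
      p ⟨s', choice σ τ (n + 1)
        (fun i => x ⟨i, Finset.mem_Iic.2 (Nat.lt_succ_iff.1 i.2)⟩) s'⟩) :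
    ∀ᵐ m ∂stepKernel σ τ n x, p m := by
  let _ : MeasurableSpace S := ⊤
  have _ : DiscreteMeasurableSpace S := ⟨fun _ => trivial⟩
  change ∀ᵐ m ∂(PMF.toMeasure _), p m
  rw [← PMF.toMeasure_map (hf := .of_discrete),
    ae_map_iff Measurable.of_discrete.aemeasurable .of_discrete, ae_iff,
    PMF.toMeasure_apply_eq_zero_iff _ .of_discrete, Set.disjoint_left]
  intro s' hs'
  simpa using h s' ((PMF.mem_support_iff _ _).1 hs')

section Play

variable (σ : G.CopStrategy) (τ : G.RobStrategy) (s : S)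

instance : IsProbabilityMeasure (playMeasure σ τ s) := by
  unfold playMeasure; infer_instance

/-- The Markov property: the play up to time `n` is continued by the trajectory kernel. -/
theorem playMeasure_eq_comp (n : ℕ) :
    playMeasure σ τ s = Kernel.traj (X := fun _ => Move S A) (stepKernel σ τ) n ∘ₘ
      (playMeasure σ τ s).map (Preorder.frestrictLe n) := by
  rw [playMeasure, Kernel.traj_map_frestrictLe_apply, ← Kernel.comp_apply,
    Kernel.traj_comp_partialTraj (Nat.zero_le n)]

theorem map_playMeasure_succ (n : ℕ) :
    (playMeasure σ τ s).map (fun ω => ω (n + 1)) = stepKernel σ τ n ∘ₘ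
      (playMeasure σ τ s).map (Preorder.frestrictLe n) := by
  conv_lhs => rw [playMeasure_eq_comp σ τ s n]
  rw [Measure.map_comp _ _ (by fun_prop), Kernel.map_traj_succ_self]

theorem ae_playMeasure_zero :
    ∀ᵐ ω ∂playMeasure σ τ s, ω 0 = ⟨s, choice σ τ 0 Fin.elim0 s⟩ := by
  have h : (playMeasure σ τ s).map (Preorder.frestrictLe 0) =
      Measure.dirac (fun _ => ⟨s, choice σ τ 0 Fin.elim0 s⟩) := by
    rw [playMeasure, Kernel.traj_map_frestrictLe_apply, Kernel.partialTraj_self, Kernel.id_apply]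
  have h2 : ∀ᵐ x ∂(playMeasure σ τ s).map (Preorder.frestrictLe 0),
      lastMove x = ⟨s, choice σ τ 0 Fin.elim0 s⟩ := by
    rw [h, ae_dirac_iff MeasurableSet.of_discrete]
  exact ae_of_ae_map (by fun_prop) h2

/-- A property of two consecutive entries that holds almost surely under the law of each step holds
almost surely along the play. -/
theorem ae_playMeasure_succ {n : ℕ} {p : Move S A → Move S A → Prop}
    (h : ∀ᵐ ω ∂playMeasure σ τ s,
      ∀ᵐ m ∂stepKernel σ τ n (Preorder.frestrictLe n ω), p (ω n) m) :
    ∀ᵐ ω ∂playMeasure σ τ s, p (ω n) (ω (n + 1)) := by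
  rw [playMeasure_eq_comp σ τ s n]
  refine Measure.ae_comp_of_ae_ae ?_ ?_
  · exact (MeasurableSet.of_discrete (s := {q : Move S A × Move S A | p q.1 q.2})).preimage
      (f := fun ω : ℕ → Move S A => (ω n, ω (n + 1))) (by fun_prop)
  · rw [ae_map_iff (by fun_prop) MeasurableSet.of_discrete]
    filter_upwards [h] with ω hω
    set x := Preorder.frestrictLe (π := fun _ => Move S A) n ω with hx
    have h1 : ∀ᵐ ω' ∂Kernel.traj (X := fun _ => Move S A) (stepKernel σ τ) n x, ω' n = ω n := by
      have : ∀ᵐ y ∂(Kernel.traj (X := fun _ => Move S A) (stepKernel σ τ) n x).map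
          (Preorder.frestrictLe n), lastMove y = lastMove x := by
        rw [Kernel.traj_map_frestrictLe_apply, Kernel.partialTraj_self, Kernel.id_apply,
          ae_dirac_iff MeasurableSet.of_discrete]
      exact ae_of_ae_map (by fun_prop) this
    have h2 : ∀ᵐ ω' ∂Kernel.traj (X := fun _ => Move S A) (stepKernel σ τ) n x,
        p (ω n) (ω' (n + 1)) := by
      rw [← Kernel.map_traj_succ_self (X := fun _ => Move S A) (κ := stepKernel σ τ),
        Kernel.map_apply _ (by fun_prop)] at hω
      exact ae_of_ae_map (measurable_pi_apply (n + 1)).aemeasurable hω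
    filter_upwards [h1, h2] with ω' e1 e2
    rwa [e1]

/-- A relation between state and action that all choices at time `n` satisfy holds almost surely
along the play. -/
theorem ae_choice {n : ℕ} {Q : S → A → Prop} (hQ : ∀ h t, Q t (choice σ τ n h t)) :
    ∀ᵐ ω ∂playMeasure σ τ s, Q (ω n).state (ω n).action := by
  cases n with
  | zero =>
    filter_upwards [ae_playMeasure_zero σ τ s] with ω hω
    rw [hω]
    exact hQ _ s
  | succ n =>
    exact ae_playMeasure_succ σ τ s (p := fun _ m => Q m.state m.action)
      (.of_forall fun ω => ae_stepKernel σ τ fun s' _ => hQ _ s')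

theorem ae_playable (n : ℕ) :
    ∀ᵐ ω ∂playMeasure σ τ s, (ω n).action ∈ G.playable n (ω n).state :=
  ae_choice σ τ s (Q := fun t a => a ∈ G.playable n t) (choice_mem_playable σ τ n)

theorem ae_mem_final_succ (n : ℕ) :
    ∀ᵐ ω ∂playMeasure σ τ s, (ω n).state ∈ G.final → (ω (n + 1)).state ∈ G.final := by
  refine ae_playMeasure_succ σ τ s (p := fun m m' => m.state ∈ G.final → m'.state ∈ G.final) ?_
  filter_upwards [ae_playable σ τ s n] with ω hω
  refine ae_stepKernel σ τ fun s' hs' hF => ?_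
  have ha : (lastMove (Preorder.frestrictLe (π := fun _ => Move S A) n ω)).action ∈
      G.playable n (lastMove (Preorder.frestrictLe (π := fun _ => Move S A) n ω)).state := hω
  rw [nextState_apply ha] at hs'
  by_contra hne
  exact hs' (ENNReal.ofReal_eq_zero.2 (trans_eq_zero_of_mem_final hF hω
    (fun h : s' = (ω n).state => hne (by rwa [h]))).le)

/-- The expectation of `f` at the state at time `n` of the play from `s`. -/
noncomputable def stateMean (n : ℕ) (f : S → ℝ) : ℝ :=
  ∫ ω, f (ω n).state ∂playMeasure σ τ s

theorem integrable_comp_move (n : ℕ) (f : Move S A → ℝ) :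
    Integrable (fun ω => f (ω n)) (playMeasure σ τ s) :=
  have := (Measure.isProbabilityMeasure_map (μ := playMeasure σ τ s)
    (measurable_pi_apply n).aemeasurable)
  (Integrable.of_finite (f := f)).comp_measurable (measurable_pi_apply n)

theorem stateMean_zero (f : S → ℝ) : stateMean σ τ s 0 f = f s := by
  have h : (fun ω : ℕ → Move S A => f (ω 0).state) =ᵐ[playMeasure σ τ s] fun _ => f s := by
    filter_upwards [ae_playMeasure_zero σ τ s] with ω hω
    rw [hω]
  rw [stateMean, integral_congr_ae h]
  simp

theorem stateMean_succ (n : ℕ) (f : S → ℝ) :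
    stateMean σ τ s (n + 1) f =
      ∫ ω, G.expect n (ω n).state (ω n).action f ∂playMeasure σ τ s := by
  have h1 : stateMean σ τ s (n + 1) f =
      ∫ m, f m.state ∂(playMeasure σ τ s).map (fun ω => ω (n + 1)) := by
    rw [integral_map (measurable_pi_apply (n + 1)).aemeasurable
      (Measurable.of_discrete (f := fun m : Move S A => f m.state)).aestronglyMeasurable]
    rfl
  have := Measure.isProbabilityMeasure_map (μ := playMeasure σ τ s)
    (Preorder.measurable_frestrictLe (X := fun _ => Move S A) n).aemeasurable
  rw [h1, map_playMeasure_succ, Measure.comp_eq_comp_const_apply, Kernel.integral_comp .of_finite,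
    Kernel.const_apply,
    integral_map (Preorder.measurable_frestrictLe (X := fun _ => Move S A) n).aemeasurable
      Measurable.of_discrete.aestronglyMeasurable]
  refine integral_congr_ae ?_
  filter_upwards [ae_playable σ τ s n] with ω hω
  exact integral_stepKernel σ τ (x := Preorder.frestrictLe (π := fun _ => Move S A) n ω) hω f

theorem stateMean_mono {n : ℕ} {f g : S → ℝ} (h : f ≤ g) :
    stateMean σ τ s n f ≤ stateMean σ τ s n g :=
  integral_mono (integrable_comp_move σ τ s n fun m => f m.state)
    (integrable_comp_move σ τ s n fun m => g m.state) fun ω => h (ω n).state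

theorem stateMean_add (n : ℕ) (f g : S → ℝ) :
    stateMean σ τ s n (f + g) = stateMean σ τ s n f + stateMean σ τ s n g :=
  integral_add (integrable_comp_move σ τ s n fun m => f m.state)
    (integrable_comp_move σ τ s n fun m => g m.state)

theorem stateMean_const_mul (n : ℕ) (c : ℝ) (f : S → ℝ) :
    stateMean σ τ s n (fun t => c * f t) = c * stateMean σ τ s n f :=
  integral_const_mul c _

variable {σ τ s}

theorem stateMean_succ_le {n : ℕ} {f g : S → ℝ}
    (h : ∀ x t, G.expect n t (choice σ τ n x t) f ≤ g t) :
    stateMean σ τ s (n + 1) f ≤ stateMean σ τ s n g := by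
  rw [stateMean_succ]
  exact integral_mono_ae (integrable_comp_move σ τ s n fun m => G.expect n m.state m.action f)
    (integrable_comp_move σ τ s n fun m => g m.state)
    (ae_choice σ τ s (Q := fun t a => G.expect n t a f ≤ g t) h)

theorem stateMean_le_succ {n : ℕ} {f g : S → ℝ}
    (h : ∀ x t, g t ≤ G.expect n t (choice σ τ n x t) f) :
    stateMean σ τ s n g ≤ stateMean σ τ s (n + 1) f := by
  rw [stateMean_succ]
  exact integral_mono_ae (integrable_comp_move σ τ s n fun m => g m.state)
    (integrable_comp_move σ τ s n fun m => G.expect n m.state m.action f)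
    (ae_choice σ τ s (Q := fun t a => g t ≤ G.expect n t a f) h)

/-! ### The capture probability as a limit -/

open Classical in
/-- The indicator function of the final states. -/
noncomputable def finalInd (G : GPCR S A) (t : S) : ℝ := if t ∈ G.final then 1 else 0

theorem finalInd_nonneg (t : S) : 0 ≤ G.finalInd t := by
  unfold finalInd; split_ifs <;> simp

theorem finalInd_le_one (t : S) : G.finalInd t ≤ 1 := by
  unfold finalInd; split_ifs <;> simp

theorem stateMean_finalInd (n : ℕ) :
    stateMean σ τ s n G.finalInd = (playMeasure σ τ s).real {ω | (ω n).state ∈ G.final} := by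
  have hm : MeasurableSet {ω : ℕ → Move S A | (ω n).state ∈ G.final} :=
    (MeasurableSet.of_discrete (s := {m : Move S A | m.state ∈ G.final})).preimage
      (measurable_pi_apply n)
  rw [stateMean, ← integral_indicator_one hm]
  refine integral_congr_ae (.of_forall fun ω => ?_)
  simp [finalInd, Set.indicator]

/-- As final states are absorbing, the capture probability is the limit of the probabilities that
the state at time `n` is final. -/
theorem tendsto_stateMean_finalInd :
    Tendsto (fun n => stateMean σ τ s n G.finalInd) atTop (𝓝 (captureProb σ τ s)) := by
  have hstay : ∀ᵐ ω ∂playMeasure σ τ s,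
      ∀ n, (ω n).state ∈ G.final → (ω (n + 1)).state ∈ G.final :=
    ae_all_iff.2 fun n => ae_mem_final_succ σ τ s n
  have hacc : ∀ n, (playMeasure σ τ s).real {ω | (ω n).state ∈ G.final} =
      (playMeasure σ τ s).real
        (Set.accumulate (fun n => {ω : ℕ → Move S A | (ω n).state ∈ G.final}) n) := by
    intro n
    refine measureReal_congr ?_
    filter_upwards [hstay] with ω hω
    refine propext ⟨fun h => Set.mem_accumulate.2 ⟨n, le_rfl, h⟩, fun h => ?_⟩
    obtain ⟨k, hk, h⟩ := Set.mem_accumulate.1 h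
    exact Nat.le_induction (P := fun m _ => (ω m).state ∈ G.final) h (fun m _ ih => hω m ih) n hk
  have hU : {ω : ℕ → Move S A | ∃ n, (ω n).state ∈ G.final} =
      ⋃ n, {ω : ℕ → Move S A | (ω n).state ∈ G.final} := by
    ext; simp
  simp_rw [stateMean_finalInd, hacc]
  rw [captureProb, hU]
  exact (ENNReal.tendsto_toReal (measure_ne_top _ _)).comp tendsto_measure_iUnion_accumulate

theorem captureProb_nonneg : 0 ≤ captureProb σ τ s := measureReal_nonneg

theorem captureProb_le_one : captureProb σ τ s ≤ 1 := measureReal_le_one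

end Play

/-! ### The max-min operator -/

variable (G) in
/-- The least expectation of `f` that the robbers can achieve with one move from `s`. -/
noncomputable def robValue (f : S → ℝ) (s : S) : ℝ :=
  (G.robPlayable s).inf' (G.robPlayable_nonempty s) fun a => ∑ s', G.Trob s a s' * f s'


theorem expect_of_even {n : ℕ} (hn : Even n) (s : S) (a : A) (f : S → ℝ) :
    G.expect n s a f = ∑ s', G.Tcop s a s' * f s' := by
  rw [expect, trans_of_even hn]

theorem expect_of_odd {n : ℕ} (hn : Odd n) (s : S) (a : A) (f : S → ℝ) :
    G.expect n s a f = ∑ s', G.Trob s a s' * f s' := by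
  rw [expect, trans_of_odd hn]

theorem robValue_eq {n : ℕ} (hn : Odd n) (f : S → ℝ) (s : S) :
    G.robValue f s =
      (G.robPlayable s).inf' (G.robPlayable_nonempty s) fun a => G.expect n s a f := by
  simp only [expect_of_odd hn, robValue]

theorem actionValue_eq {n : ℕ} (hn : Even n) (f : S → ℝ) (s : S) (a : A) :
    G.actionValue f s a = G.expect n s a (G.robValue f) := by
  rw [expect_of_even hn]
  rfl

theorem robValue_le_expect {n : ℕ} (hn : Odd n) (f : S → ℝ) {s : S} {a : A}
    (ha : a ∈ G.robPlayable s) : G.robValue f s ≤ G.expect n s a f := by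
  rw [robValue_eq hn]
  exact Finset.inf'_le _ ha

theorem exists_expect_eq_robValue (f : S → ℝ) (s : S) :
    ∃ a ∈ G.robPlayable s, ∀ n, Odd n → G.expect n s a f = G.robValue f s := by
  obtain ⟨a, ha, h⟩ := Finset.exists_mem_eq_inf' (G.robPlayable_nonempty s)
    (fun a => ∑ s', G.Trob s a s' * f s')
  exact ⟨a, ha, fun n hn => by rw [expect_of_odd hn, robValue, h]⟩

theorem robValue_mono : Monotone G.robValue := by
  intro f g h s
  refine Finset.le_inf' _ _ fun a ha => ?_
  refine (Finset.inf'_le _ ha).trans ?_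
  have := expect_mono (n := 1) (a := a) (by rwa [playable_of_odd odd_one]) h
  rwa [expect_of_odd odd_one, expect_of_odd odd_one] at this

theorem robValue_const (c : ℝ) (s : S) : G.robValue (fun _ => c) s = c := by
  obtain ⟨a, ha, h⟩ := exists_expect_eq_robValue (G := G) (fun _ => c) s
  rw [← h 1 odd_one, expect_const (by rwa [playable_of_odd odd_one])]

theorem robValue_const_mul {c : ℝ} (hc : 0 ≤ c) (f : S → ℝ) (s : S) :
    G.robValue (fun t => c * f t) s = c * G.robValue f s := by
  refine le_antisymm ?_ ?_
  · obtain ⟨a, ha, h⟩ := exists_expect_eq_robValue (G := G) f s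
    rw [← h 1 odd_one, ← expect_const_mul]
    exact robValue_le_expect odd_one _ ha
  · obtain ⟨a, ha, h⟩ := exists_expect_eq_robValue (G := G) (fun t => c * f t) s
    rw [← h 1 odd_one, expect_const_mul]
    exact mul_le_mul_of_nonneg_left (robValue_le_expect odd_one _ ha) hc

theorem robValue_of_mem_final {s : S} (hs : s ∈ G.final) (f : S → ℝ) : G.robValue f s = f s := by
  obtain ⟨a, ha, h⟩ := exists_expect_eq_robValue (G := G) f s
  rw [← h 1 odd_one, expect_of_mem_final hs (by rwa [playable_of_odd odd_one])]

theorem actionValue_mono {f g : S → ℝ} (h : f ≤ g) {s : S} {a : A} (ha : a ∈ G.copPlayable s) :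
    G.actionValue f s a ≤ G.actionValue g s a := by
  rw [actionValue_eq Even.zero, actionValue_eq Even.zero]
  exact expect_mono (by rwa [playable_of_even Even.zero]) (robValue_mono h)

theorem actionValue_const_mul {c : ℝ} (hc : 0 ≤ c) (f : S → ℝ) (s : S) (a : A) :
    G.actionValue (fun t => c * f t) s a = c * G.actionValue f s a := by
  rw [actionValue_eq Even.zero, actionValue_eq Even.zero, ← expect_const_mul]
  congr 1
  exact funext fun t => robValue_const_mul hc f t

theorem actionValue_const (c : ℝ) {s : S} {a : A} (ha : a ∈ G.copPlayable s) :
    G.actionValue (fun _ => c) s a = c := by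
  rw [actionValue_eq Even.zero, funext (robValue_const c),
    expect_const (by rwa [playable_of_even Even.zero])]

theorem operator_of_mem {s : S} (hs : s ∈ G.final) (f : S → ℝ) : G.operator f s = 1 := if_pos hs

theorem operator_of_notMem {s : S} (hs : s ∉ G.final) (f : S → ℝ) :
    G.operator f s =
      (G.copPlayable s).sup' (G.copPlayable_nonempty s) fun a => G.actionValue f s a :=
  if_neg hs

theorem operator_mono : Monotone G.operator := by
  intro f g h s
  by_cases hs : s ∈ G.final
  · rw [operator_of_mem hs, operator_of_mem hs]
  · rw [operator_of_notMem hs, operator_of_notMem hs]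
    exact Finset.sup'_mono_fun fun a ha => actionValue_mono h ha

theorem operator_mapsTo : Set.MapsTo G.operator (Set.Icc 0 1) (Set.Icc 0 1) := by
  rintro f ⟨h0, h1⟩
  refine ⟨fun s => ?_, fun s => ?_⟩
  all_goals
    by_cases hs : s ∈ G.final
    · simp [operator_of_mem hs]
    rw [operator_of_notMem hs]
  · obtain ⟨a, ha⟩ := G.copPlayable_nonempty s
    refine le_trans ?_ (Finset.le_sup' _ ha)
    rw [Pi.zero_apply, ← actionValue_const 0 ha]
    exact actionValue_mono h0 ha
  · refine Finset.sup'_le _ _ fun a ha => ?_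
    rw [Pi.one_apply, ← actionValue_const 1 ha]
    exact actionValue_mono h1 ha

theorem continuous_operator : Continuous G.operator := by
  refine continuous_pi fun s => ?_
  by_cases hs : s ∈ G.final
  · simp only [operator_of_mem hs]
    exact continuous_const
  · simp only [operator_of_notMem hs]
    refine Continuous.finset_sup'_apply _ fun a _ => ?_
    refine continuous_finsetSum _ fun s' _ => continuous_const.mul ?_
    refine Continuous.finset_inf'_apply _ fun a' _ => ?_
    fun_prop

/-! ### The limit of the recursion -/

theorem w_zero : G.w 0 = G.finalInd := rfl

theorem w_succ (n : ℕ) : G.w (n + 1) = G.operator (G.w n) := rfl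

theorem w_mem_Icc (n : ℕ) : G.w n ∈ Set.Icc (0 : S → ℝ) 1 := by
  induction n with
  | zero => exact ⟨finalInd_nonneg, finalInd_le_one⟩
  | succ n ih => exact operator_mapsTo ih

theorem finalInd_le_operator {f : S → ℝ} (hf : f ∈ Set.Icc (0 : S → ℝ) 1) :
    G.finalInd ≤ G.operator f := by
  intro s
  by_cases hs : s ∈ G.final
  · rw [operator_of_mem hs]
    exact finalInd_le_one s
  · rw [finalInd, if_neg hs]
    exact (operator_mapsTo hf).1 s

theorem w_mono : Monotone G.w := by
  refine monotone_nat_of_le_succ fun n => ?_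
  induction n with
  | zero => exact finalInd_le_operator (w_mem_Icc 0)
  | succ n ih => exact operator_mono ih

variable (G) in
/-- The pointwise limit of the sequence `w`, written as a supremum as the sequence increases. -/
noncomputable def wLim (s : S) : ℝ := ⨆ n, G.w n s

theorem bddAbove_w (s : S) : BddAbove (Set.range fun n => G.w n s) :=
  ⟨1, by rintro _ ⟨n, rfl⟩; exact (w_mem_Icc n).2 s⟩

theorem tendsto_w : Tendsto G.w atTop (𝓝 G.wLim) :=
  tendsto_pi_nhds.2 fun s =>
    tendsto_atTop_ciSup (fun _ _ h => w_mono h s) (bddAbove_w s)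

theorem operator_wLim : G.operator G.wLim = G.wLim :=
  tendsto_nhds_unique ((continuous_operator.tendsto _).comp tendsto_w)
    (tendsto_w.comp (tendsto_add_atTop_nat 1))

theorem wLim_of_mem_final {s : S} (hs : s ∈ G.final) : G.wLim s = 1 := by
  rw [← operator_wLim, operator_of_mem hs]

theorem actionValue_wLim_le {s : S} (hs : s ∉ G.final) {a : A} (ha : a ∈ G.copPlayable s) :
    G.actionValue G.wLim s a ≤ G.wLim s := by
  conv_rhs => rw [← operator_wLim, operator_of_notMem hs]
  exact Finset.le_sup' (fun a => G.actionValue G.wLim s a) ha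

theorem finalInd_le_wLim : G.finalInd ≤ G.wLim := fun s => le_ciSup (bddAbove_w s) 0

theorem isLeast_wLim : IsLeast {f : S → ℝ | f ∈ Set.Icc 0 1 ∧ G.operator f = f} G.wLim := by
  refine ⟨⟨⟨fun s => (finalInd_nonneg s).trans (finalInd_le_wLim s),
    fun s => ciSup_le fun n => (w_mem_Icc n).2 s⟩, operator_wLim⟩, ?_⟩
  rintro f ⟨hf, hfix⟩ s
  refine ciSup_le fun n => ?_
  suffices h : G.w n ≤ f from h s
  induction n with
  | zero =>
    rw [w_zero, ← hfix]
    exact finalInd_le_operator hf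
  | succ n ih =>
    rw [w_succ, ← hfix]
    exact operator_mono ih

/-! ### Potentials along the play -/

variable (G) in
/-- The function that agrees with `f` when the cops move and with the robbers' one-move value of `f`
when the robbers move. -/
noncomputable def potential (f : S → ℝ) (n : ℕ) : S → ℝ :=
  if Even n then f else G.robValue f

theorem potential_of_even {n : ℕ} (hn : Even n) (f : S → ℝ) : G.potential f n = f := if_pos hn

theorem potential_of_odd {n : ℕ} (hn : Odd n) (f : S → ℝ) :
    G.potential f n = G.robValue f := if_neg (Nat.not_even_iff_odd.2 hn)

theorem potential_of_mem_final {s : S} (hs : s ∈ G.final) (f : S → ℝ) (n : ℕ) :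
    G.potential f n s = f s := by
  rcases Nat.even_or_odd n with hn | hn
  · rw [potential_of_even hn]
  · rw [potential_of_odd hn, robValue_of_mem_final hs]

theorem finalInd_le_potential {f : S → ℝ} (hf : G.finalInd ≤ f) (n : ℕ) :
    G.finalInd ≤ G.potential f n := by
  intro s
  by_cases hs : s ∈ G.final
  · rw [potential_of_mem_final hs]
    exact hf s
  · rcases Nat.even_or_odd n with hn | hn
    · rw [potential_of_even hn]
      exact hf s
    · rw [potential_of_odd hn, finalInd, if_neg hs, ← robValue_const (G := G) 0 s]
      exact robValue_mono (fun t => (finalInd_nonneg t).trans (hf t)) s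

theorem expect_potential_succ_of_even {n : ℕ} (hn : Even n) (f : S → ℝ) (s : S) (a : A) :
    G.expect n s a (G.potential f (n + 1)) = G.actionValue f s a := by
  rw [potential_of_odd hn.add_one, actionValue_eq hn]

/-! ### The robbers' side -/

theorem exists_robMemoryless_minimizing (f : S → ℝ) :
    ∃ τ : G.RobMemoryless, ∀ t n, Odd n → G.expect n t (τ.1 t) f = G.robValue f t := by
  choose τ hτ h using exists_expect_eq_robValue (G := G) f
  exact ⟨⟨τ, hτ⟩, h⟩

section Robbers

variable {τ : G.RobMemoryless} {σ : G.CopStrategy} {s : S}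

/-- Against robbers who minimize the expectation of `wLim`, the potential of `wLim` is a
supermartingale. -/
theorem antitone_stateMean_potential
    (hτ : ∀ t n, Odd n → G.expect n t (τ.1 t) G.wLim = G.robValue G.wLim t) :
    Antitone fun n => stateMean σ τ.toGen s n (G.potential G.wLim n) := by
  refine antitone_nat_of_succ_le fun n => stateMean_succ_le fun x t => ?_
  have ha := choice_mem_playable σ τ.toGen n x t
  rcases Nat.even_or_odd n with hn | hn
  · rw [expect_potential_succ_of_even hn, potential_of_even hn]
    by_cases ht : t ∈ G.final
    · rw [actionValue_eq hn, expect_of_mem_final ht ha, robValue_of_mem_final ht]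
    · rw [playable_of_even hn] at ha
      exact actionValue_wLim_le ht ha
  · rw [potential_of_even hn.add_one, potential_of_odd hn, choice,
      if_neg (Nat.not_even_iff_odd.2 hn)]
    exact (hτ t n hn).le

theorem captureProb_le_stateMean
    (hτ : ∀ t n, Odd n → G.expect n t (τ.1 t) G.wLim = G.robValue G.wLim t) (n : ℕ) :
    captureProb σ τ.toGen s ≤ stateMean σ τ.toGen s n (G.potential G.wLim n) := by
  refine le_of_tendsto tendsto_stateMean_finalInd (eventually_atTop.2 ⟨n, fun m hm => ?_⟩)
  exact (stateMean_mono σ τ.toGen s (finalInd_le_potential finalInd_le_wLim m)).trans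
    (antitone_stateMean_potential hτ hm)

theorem captureProb_le_wLim
    (hτ : ∀ t n, Odd n → G.expect n t (τ.1 t) G.wLim = G.robValue G.wLim t) :
    captureProb σ τ.toGen s ≤ G.wLim s := by
  have h := captureProb_le_stateMean (σ := σ) (s := s) hτ 0
  rwa [stateMean_zero, potential_of_even Even.zero] at h

/-- Against minimizing robbers, the first action of the cops already limits the capture probability
to the value of that action. -/
theorem captureProb_le_actionValue
    (hτ : ∀ t n, Odd n → G.expect n t (τ.1 t) G.wLim = G.robValue G.wLim t)
    (σ : G.CopMemoryless) :
    captureProb σ.toGen τ.toGen s ≤ G.actionValue G.wLim s (σ.1 s) := by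
  refine (captureProb_le_stateMean hτ 1).trans ?_
  refine (stateMean_succ_le (g := fun t => G.actionValue G.wLim t (σ.1 t)) fun x t => ?_).trans
    (stateMean_zero _ _ _ _).le
  rw [expect_potential_succ_of_even Even.zero, choice, if_pos Even.zero]
  rfl

end Robbers

/-! ### The cops' side -/

/-- Suppose that `g` is `1` at final states and that elsewhere the actions of the memoryless
strategy `σ` promise at least `g / c` with `c < 1`. Then `σ` guarantees `g`. -/
theorem le_captureProb_of_le_mul_actionValue {g : S → ℝ} {c : ℝ} (hc0 : 0 < c) (hc1 : c < 1)
    (hg : G.finalInd ≤ g) (hgF : ∀ t ∈ G.final, g t = 1) {σ : G.CopMemoryless}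
    (hσ : ∀ t ∉ G.final, g t ≤ c * G.actionValue g t (σ.1 t)) (τ : G.RobStrategy) (s : S) :
    g s ≤ captureProb σ.toGen τ s := by
  set x : ℕ → ℝ := fun n => stateMean σ.toGen τ s n (G.potential g n) with hx
  set p : ℕ → ℝ := fun n => stateMean σ.toGen τ s n G.finalInd with hp
  have hp_lim : Tendsto p atTop (𝓝 (captureProb σ.toGen τ s)) := tendsto_stateMean_finalInd
  have hpx : ∀ n, p n ≤ x n := fun n => stateMean_mono _ _ _ (finalInd_le_potential hg n)
  have hg0 : ∀ t, 0 ≤ g t := fun t => (finalInd_nonneg t).trans (hg t)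
  have hodd : ∀ n, Odd n → x n ≤ x (n + 1) := by
    intro n hn
    refine stateMean_le_succ fun h t => ?_
    have ha := choice_mem_playable σ.toGen τ n h t
    rw [playable_of_odd hn] at ha
    rw [potential_of_odd hn, potential_of_even hn.add_one]
    exact robValue_le_expect hn g ha
  have heven : ∀ n, Even n → x n ≤ c * x (n + 1) + (1 - c) * p n := by
    intro n hn
    have h := stateMean_le_succ (σ := σ.toGen) (τ := τ) (s := s) (n := n)
      (f := fun t => c * G.potential g (n + 1) t)
      (g := G.potential g n + fun t => (c - 1) * G.finalInd t) fun h t => by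
        rw [expect_const_mul, expect_potential_succ_of_even hn, potential_of_even hn,
          choice, if_pos hn]
        change g t + (c - 1) * G.finalInd t ≤ c * G.actionValue g t (σ.1 t)
        by_cases ht : t ∈ G.final
        · rw [actionValue_eq hn, expect_of_mem_final ht (by
            rw [playable_of_even hn]; exact σ.2 t), robValue_of_mem_final ht, hgF t ht,
            finalInd, if_pos ht]
          linarith
        · rw [finalInd, if_neg ht, mul_zero, add_zero]
          exact hσ t ht
    rw [stateMean_add, stateMean_const_mul, stateMean_const_mul] at h
    change x n + (c - 1) * p n ≤ c * x (n + 1) at h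
    linarith
  have hmono : Monotone x := by
    refine monotone_nat_of_le_succ fun n => ?_
    rcases Nat.even_or_odd n with hn | hn
    · have h1 := heven n hn
      have h2 := hpx n
      -- `x n ≤ c * x (n + 1) + (1 - c) * x n`, where `c > 0`
      have h3 : c * x n ≤ c * x (n + 1) := by nlinarith
      exact le_of_mul_le_mul_left h3 hc0
    · exact hodd n hn
  obtain ⟨B, hB⟩ : ∃ B, ∀ n t, G.potential g n t ≤ B := by
    obtain ⟨B, hB⟩ := (Set.finite_range g).bddAbove
    have hB' : g ≤ fun _ => B := fun t => hB ⟨t, rfl⟩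
    refine ⟨B, fun n t => ?_⟩
    rcases Nat.even_or_odd n with hn | hn
    · rw [potential_of_even hn]
      exact hB' t
    · rw [potential_of_odd hn, ← robValue_const (G := G) B t]
      exact robValue_mono hB' t
  have hbdd : BddAbove (Set.range x) := by
    refine ⟨B, ?_⟩
    rintro _ ⟨n, rfl⟩
    refine (stateMean_mono _ _ _ (g := fun _ => B) (hB n)).trans ?_
    simp [stateMean]
  have hx_lim := tendsto_atTop_ciSup hmono hbdd
  set L := ⨆ n, x n with hL
  have hsub : Tendsto (fun n : ℕ => 2 * n) atTop atTop :=
    tendsto_id.const_mul_atTop' (by norm_num)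
  -- the inequality `heven`, in the limit along the even times
  have hle : L ≤ c * L + (1 - c) * captureProb σ.toGen τ s :=
    le_of_tendsto_of_tendsto' (hx_lim.comp hsub)
      (((hx_lim.comp ((tendsto_add_atTop_nat 1).comp hsub)).const_mul c).add
        ((hp_lim.comp hsub).const_mul (1 - c)))
      fun n => heven (2 * n) (even_two_mul n)
  have hLP : L ≤ captureProb σ.toGen τ s := by
    refine le_of_mul_le_mul_left ?_ (sub_pos.2 hc1)
    linarith
  have h0 : x 0 = g s := by
    rw [hx]
    exact (stateMean_zero _ _ _ _).trans (by rw [potential_of_even Even.zero])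
  exact h0 ▸ (le_ciSup hbdd 0).trans hLP

/-- For `c < 1`, some memoryless strategy of the cops guarantees `c ^ n * w n` for all `n`. -/
theorem exists_copMemoryless_pow_mul_w_le {c : ℝ} (hc0 : 0 < c) (hc1 : c < 1) :
    ∃ σ : G.CopMemoryless, ∀ τ s n, c ^ n * G.w n s ≤ captureProb σ.toGen τ s := by
  -- the discounted value with horizon chosen by the cops
  set g : S → ℝ := fun s => ⨆ n, c ^ n * G.w n s with hg
  have hle1 : ∀ s n, c ^ n * G.w n s ≤ 1 := fun s n =>
    mul_le_one₀ (pow_le_one₀ hc0.le hc1.le) ((w_mem_Icc n).1 s) ((w_mem_Icc n).2 s)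
  have hbdd : ∀ s, BddAbove (Set.range fun n => c ^ n * G.w n s) := fun s =>
    ⟨1, by rintro _ ⟨n, rfl⟩; exact hle1 s n⟩
  have hwg : ∀ s n, c ^ n * G.w n s ≤ g s := fun s n => le_ciSup (hbdd s) n
  have hfin : G.finalInd ≤ g := fun s => by
    have := hwg s 0
    rwa [pow_zero, one_mul] at this
  have hgF : ∀ t ∈ G.final, g t = 1 := fun t ht =>
    le_antisymm (ciSup_le (hle1 t)) (by
      have := hfin t
      rwa [finalInd, if_pos ht] at this)
  have hmax : ∀ s, ∃ a ∈ G.copPlayable s, ∀ b ∈ G.copPlayable s,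
      G.actionValue g s b ≤ G.actionValue g s a := fun s =>
    Finset.exists_max_image _ _ (G.copPlayable_nonempty s)
  choose σ hσ hσmax using hmax
  refine ⟨⟨σ, hσ⟩, fun τ s n => (hwg s n).trans ?_⟩
  refine le_captureProb_of_le_mul_actionValue hc0 hc1 hfin hgF (fun t ht => ciSup_le fun n => ?_)
    τ s
  cases n with
  | zero =>
    rw [w_zero, finalInd, if_neg ht, mul_zero]
    refine mul_nonneg hc0.le ?_
    rw [← actionValue_const 0 (hσ t)]
    exact actionValue_mono (fun t => (finalInd_nonneg t).trans (hfin t)) (hσ t)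
  | succ n =>
    rw [w_succ, operator_of_notMem ht, pow_succ', mul_assoc]
    refine mul_le_mul_of_nonneg_left ?_ hc0.le
    obtain ⟨a, ha, h⟩ := Finset.exists_mem_eq_sup' (G.copPlayable_nonempty t)
      (fun a => G.actionValue (G.w n) t a)
    rw [h, ← actionValue_const_mul (pow_nonneg hc0.le n)]
    exact (actionValue_mono (fun t => hwg t n) ha).trans (hσmax t a ha)

/-- As there are only finitely many memoryless strategies, one of them works for discount factors
arbitrarily close to `1`, and it guarantees `wLim`. -/
theorem exists_copMemoryless_wLim_le :
    ∃ σ : G.CopMemoryless, ∀ τ s, G.wLim s ≤ captureProb σ.toGen τ s := by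
  have hc0 : ∀ k : ℕ, (0 : ℝ) < 1 - 1 / ((k : ℝ) + 2) := fun k => by
    rw [sub_pos, div_lt_one (by positivity)]
    linarith [(Nat.cast_nonneg k : (0 : ℝ) ≤ k)]
  have hc1 : ∀ k : ℕ, 1 - 1 / ((k : ℝ) + 2) < 1 := fun k => by
    have : (0 : ℝ) < 1 / ((k : ℝ) + 2) := by positivity
    linarith
  have hlim : Tendsto (fun k : ℕ => 1 - 1 / ((k : ℝ) + 2)) atTop (𝓝 1) := by
    have : Tendsto (fun k : ℕ => 1 / ((k : ℝ) + 2)) atTop (𝓝 0) :=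
      tendsto_const_nhds.div_atTop
        (tendsto_atTop_add_const_right _ _ tendsto_natCast_atTop_atTop)
    simpa using this.const_sub 1
  choose σ hσ using fun k => exists_copMemoryless_pow_mul_w_le (G := G) (hc0 k) (hc1 k)
  have : Finite G.CopMemoryless := Subtype.finite
  obtain ⟨σ', hσ'⟩ := Finite.exists_infinite_fiber σ
  refine ⟨σ', fun τ s => ciSup_le fun n => ?_⟩
  have hfreq : ∃ᶠ k in atTop, σ k = σ' :=
    Nat.frequently_atTop_iff_infinite.2 (Set.infinite_coe_iff.1 hσ')
  have ht : Tendsto (fun k : ℕ => (1 - 1 / ((k : ℝ) + 2)) ^ n * G.w n s) atTop (𝓝 (G.w n s)) := by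
    simpa using (hlim.pow n).mul_const (G.w n s)
  exact le_of_tendsto_of_frequently ht (hfreq.mono fun k hk => hk ▸ hσ k τ s n)

end GPCR

/-! ### The value of the game -/

/-- A saddle point of a bounded payoff yields the value of the game. -/
theorem isGameValue_of_saddle {X Y : Type*} {f : X → Y → ℝ} {v : ℝ} {x₀ : X} {y₀ : Y}
    (h0 : ∀ x y, 0 ≤ f x y) (h1 : ∀ x y, f x y ≤ 1)
    (hx : ∀ y, v ≤ f x₀ y) (hy : ∀ x, f x y₀ ≤ v) : IsGameValue f v := by
  have : Nonempty X := ⟨x₀⟩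
  have : Nonempty Y := ⟨y₀⟩
  have hb : ∀ x, BddBelow (Set.range fun y => f x y) := fun x =>
    ⟨0, by rintro _ ⟨y, rfl⟩; exact h0 x y⟩
  have ha : ∀ y, BddAbove (Set.range fun x => f x y) := fun y =>
    ⟨1, by rintro _ ⟨x, rfl⟩; exact h1 x y⟩
  have hle : ∀ x, ⨅ y, f x y ≤ v := fun x => (ciInf_le (hb x) y₀).trans (hy x)
  have hge : ∀ y, v ≤ ⨆ x, f x y := fun y => (hx y).trans (le_ciSup (ha y) x₀)
  refine ⟨⟨⟨x₀, le_antisymm (hle x₀) (le_ciInf hx)⟩, ?_⟩,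
    ⟨⟨y₀, le_antisymm (ciSup_le hy) (hge y₀)⟩, ?_⟩⟩
  · rintro _ ⟨x, rfl⟩
    exact hle x
  · rintro _ ⟨y, rfl⟩
    exact hge y


theorem mainTheorem3 {S A : Type*} [Fintype S] [Fintype A] (G : GPCR S A) :
    -- the max-min operator is monotone and preserves the functions with values in [0,1]
    Monotone G.operator ∧
    Set.MapsTo G.operator (Set.Icc 0 1) (Set.Icc 0 1) ∧
    ∃ wInf : S → ℝ,
      -- the pointwise limit exists
      (∀ s, Tendsto (fun n => G.w n s) atTop (𝓝 (wInf s))) ∧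
      -- it satisfies the max-min equation
      (∀ s, s ∈ G.final → wInf s = 1) ∧
      (∀ s, s ∉ G.final →
        wInf s = (G.copPlayable s).sup' (G.copPlayable_nonempty s) (fun a =>
          ∑ s', G.Tcop s a s' *
            (G.robPlayable s').inf' (G.robPlayable_nonempty s') (fun a' =>
              ∑ s'', G.Trob s' a' s'' * wInf s''))) ∧
      -- it is the least fixed point of the operator on functions with values in [0,1]
      IsLeast {f : S → ℝ | f ∈ Set.Icc 0 1 ∧ G.operator f = f} wInf ∧
      -- it is the value of the infinite game from each state, over general strategies and over
      -- memoryless strategies; in particular from the initial state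
      (∀ s, IsGameValue
        (fun (σ : G.CopStrategy) (τ : G.RobStrategy) => GPCR.captureProb σ τ s) (wInf s)) ∧
      (∀ s, IsGameValue
        (fun (σ : G.CopMemoryless) (τ : G.RobMemoryless) =>
          GPCR.captureProb σ.toGen τ.toGen s) (wInf s)) ∧
      wInf G.start = G.value ∧
      -- some selection of maximizing actions is a memoryless strategy optimal from every state
      (∃ σ : G.CopMemoryless, GPCR.AttainsMax wInf σ ∧ ∀ s, GPCR.IsOptimalFrom σ.toGen s) ∧
      -- every memoryless strategy optimal from every state consists of maximizing actions
      (∀ σ : G.CopMemoryless, (∀ s, GPCR.IsOptimalFrom σ.toGen s) → GPCR.AttainsMax wInf σ) := by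
  obtain ⟨σ, hσ⟩ := GPCR.exists_copMemoryless_wLim_le (G := G)
  obtain ⟨τ, hτ⟩ := GPCR.exists_robMemoryless_minimizing (G := G) G.wLim
  have hτle : ∀ (σ' : G.CopStrategy) s, GPCR.captureProb σ' τ.toGen s ≤ G.wLim s :=
    fun σ' s => GPCR.captureProb_le_wLim hτ
  have hbdd : ∀ (σ' : G.CopStrategy) s,
      BddBelow (Set.range fun τ' : G.RobStrategy => GPCR.captureProb σ' τ' s) := fun σ' s =>
    ⟨0, by rintro _ ⟨τ', rfl⟩; exact GPCR.captureProb_nonneg⟩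
  have : Nonempty G.RobStrategy := ⟨τ.toGen⟩
  have hopt : ∀ s, GPCR.IsOptimalFrom σ.toGen s := fun s σ' =>
    ((ciInf_le (hbdd σ' s) τ.toGen).trans (hτle σ' s)).trans (le_ciInf fun τ' => hσ τ' s)
  have hconv : ∀ σ' : G.CopMemoryless, (∀ s, GPCR.IsOptimalFrom σ'.toGen s) →
      GPCR.AttainsMax G.wLim σ' := fun σ' hσ' s hs a ha =>
    calc G.actionValue G.wLim s a ≤ G.wLim s := GPCR.actionValue_wLim_le hs ha
      _ ≤ ⨅ τ' : G.RobStrategy, GPCR.captureProb σ.toGen τ' s := le_ciInf fun τ' => hσ τ' s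
      _ ≤ ⨅ τ' : G.RobStrategy, GPCR.captureProb σ'.toGen τ' s := hσ' s σ.toGen
      _ ≤ GPCR.captureProb σ'.toGen τ.toGen s := ciInf_le (hbdd σ'.toGen s) τ.toGen
      _ ≤ G.actionValue G.wLim s (σ'.1 s) := GPCR.captureProb_le_actionValue hτ σ'
  have hmem : ∀ s, IsGameValue (fun (σ : G.CopMemoryless) (τ : G.RobMemoryless) =>
      GPCR.captureProb σ.toGen τ.toGen s) (G.wLim s) := fun s =>
    isGameValue_of_saddle (fun _ _ => GPCR.captureProb_nonneg)
      (fun _ _ => GPCR.captureProb_le_one) (fun τ' => hσ τ'.toGen s) (fun σ' => hτle σ'.toGen s)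
  exact ⟨GPCR.operator_mono, GPCR.operator_mapsTo, G.wLim, tendsto_pi_nhds.1 GPCR.tendsto_w,
    fun s hs => GPCR.wLim_of_mem_final hs,
    fun s hs => (congrFun GPCR.operator_wLim s).symm.trans (GPCR.operator_of_notMem hs _),
    GPCR.isLeast_wLim,
    fun s => isGameValue_of_saddle (fun _ _ => GPCR.captureProb_nonneg)
      (fun _ _ => GPCR.captureProb_le_one) (fun τ' => hσ τ' s) (fun σ' => hτle σ' s),
    hmem, (hmem G.start).1.csSup_eq.symm, ⟨σ, hconv σ hopt, hopt⟩, hconv⟩
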